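/- Let $(Y,\mu)$ be a standard probability space, i.e. a standard Borel space $Y$ with a Borel probability measure $\mu$ (atoms are allowed). Let $R_Y$ be a countable Borel equivalence relation on $Y$, i.e. an equivalence relation whose classes are all countable (possibly finite) and which is a Borel subset of $Y\times Y$. Write $[R_Y]$ for the group of Borel automorphisms $\varphi$ of $Y$ whose graph is included in $R_Y$, i.e. $(y,\varphi(y))\in R_Y$ for every $y\in Y$. Assume that $R_Y$ preserves $\mu$, i.e. every element of $[R_Y]$ preserves $\mu$. A sequence $(B_n)_{n\in\mathbb N}$ of Borel subsets of $Y$ is called $\mu$-asymptotically $R_Y$-invariant if $\mu(\varphi(B_n)\,\triangle\, B_n)\to 0$ as $n\to\infty$ for every $\varphi\in[R_Y]$. Then a sequence $(B_n)_{n\in\mathbb N}$ of Borel subsets of $Y$ is $\mu$-asymptotically $R_Y$-invariant if and only if, for every Borel map $\phi:Y\to Y$ (not necessarily bijective) whose graph is included in $R_Y$, $$\mu\big(\phi^{-1}(B_n)\,\triangle\, B_n\big)\longrightarrow 0\quad\text{as } n\to\infty .$$ -/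

import Mathlib

open MeasureTheory Filter Topology
open scoped symmDiff

/-- A countable Borel equivalence relation on a measurable space: every equivalence class is
countable, and the relation is a measurable subset of the square. -/
structure IsCountableBorelRel {Y : Type*} [MeasurableSpace Y] (R : Setoid Y) : Prop where
  countable_classes : ∀ x : Y, {y : Y | R x y}.Countable
  measurableSet_graph : MeasurableSet {p : Y × Y | R p.1 p.2}

/-- The full group `[R]`: the Borel automorphisms whose graph is included in `R`. -/
def borelFullGroup {Y : Type*} [MeasurableSpace Y] (R : Setoid Y) : Set (Y ≃ᵐ Y) :=
  {φ | ∀ y : Y, R y (φ y)}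

/-- The measure `μ` is `R`-invariant: every element of `[R]` preserves `μ`. -/
def IsRelInvariantMeasure {Y : Type*} [MeasurableSpace Y] (R : Setoid Y) (μ : Measure Y) : Prop :=
  ∀ φ ∈ borelFullGroup R, MeasurePreserving φ μ μ

/-- The sequence of sets `B` is asymptotically `R`-invariant with respect to `μ`:
`μ (φ(B_n) Δ B_n) → 0` for every `φ ∈ [R]`. -/
def IsAsympInvariant {Y : Type*} [MeasurableSpace Y] (R : Setoid Y) (μ : Measure Y)
    (B : ℕ → Set Y) : Prop :=
  ∀ φ ∈ borelFullGroup R, Tendsto (fun n => μ ((φ '' B n) ∆ B n)) atTop (𝓝 0)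

/-!
Only the passage from automorphisms to arbitrary Borel maps needs an argument; the converse applies
the hypothesis to `φ.symm`, since the image of a set under `φ` is its preimage under `φ.symm`.

Let `φ` be a Borel map with graph in `R`. The key point is that, up to a `μ`-null set, `Y` is a
countable union of Borel sets on each of which `φ` agrees with an element of the full group
(`exists_ae_cover_eqOn_borelFullGroup`). On such a piece `φ ⁻¹' B n ∆ B n` is controlled by
asymptotic invariance, and as `μ` is finite, convergence to `0` on every piece gives convergence to
`0` on `Y` (`tendsto_measure_zero_of_ae_cover`).

On the set of fixed points `φ` agrees with the identity. If `A` is a Borel set disjoint from its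
image `φ '' A` and `φ` is injective on `A`, then exchanging `A` and `φ '' A` along `φ` and fixing all
other points is a Borel involution in the full group (`exists_swap_of_injOn`). It remains to cover
almost every nonfixed point by countably many such sets. Since `φ` has countable fibres, this would
follow from the Lusin–Novikov theorem, but a cover up to a null set is easier. Disintegrate
`μ` along `φ` into measures `κ z` carried by the fibres `φ ⁻¹' {z}`. The fibres being countable,
almost every `y` is an atom of `κ (φ y)` (`exists_kernel_fiber_singleton_ne_zero`). For a Borel set
`D`, no two points of `D` in one fibre can each carry more than half of the `κ`-mass of `D`; thus
`φ` is injective on the set of `y ∈ D` with `κ (φ y) D < 2 * κ (φ y) {y}`. Letting `D` run through a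
countable basis of a Polish topology captures every atom.
-/

/-! ### Convergence to zero of measures, piece by piece -/

/-- For a finite measure, a sequence of sets whose traces on the members of a countable
almost-everywhere cover all have measure tending to `0` has itself measure tending to `0`. -/
theorem tendsto_measure_zero_of_ae_cover {Y : Type*} [MeasurableSpace Y] {μ : Measure Y}
    [IsFiniteMeasure μ] {A : ℕ → Set Y} (hA : ∀ k, MeasurableSet (A k))
    (hcover : ∀ᵐ y ∂μ, ∃ k, y ∈ A k) {E : ℕ → Set Y}
    (hE : ∀ k, Tendsto (fun n => μ (E n ∩ A k)) atTop (𝓝 0)) :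
    Tendsto (fun n => μ (E n)) atTop (𝓝 0) := by
  have htail : Tendsto (fun K : ℕ => μ (⋂ k ≤ K, (A k)ᶜ)) atTop (𝓝 0) := by
    have hnull : μ (⋂ k, (A k)ᶜ) = 0 := by
      rw [measure_eq_zero_iff_ae_notMem]
      filter_upwards [hcover] with y hy
      simpa using hy
    simpa only [hnull] using tendsto_measure_iInter_le (μ := μ) (f := fun k => (A k)ᶜ)
      (fun k => (hA k).compl.nullMeasurableSet) ⟨0, measure_ne_top μ _⟩
  rw [ENNReal.tendsto_nhds_zero]
  intro ε hε
  have hε2 : 0 < ε / 2 := ENNReal.half_pos hε.ne'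
  obtain ⟨K, hK⟩ := (ENNReal.tendsto_nhds_zero.1 htail (ε / 2) hε2).exists
  have hsum : Tendsto (fun n => ∑ k ∈ Finset.range (K + 1), μ (E n ∩ A k)) atTop (𝓝 0) := by
    simpa using tendsto_finsetSum (Finset.range (K + 1)) fun k _ => hE k
  filter_upwards [ENNReal.tendsto_nhds_zero.1 hsum (ε / 2) hε2] with n hn
  have hsub : E n ⊆ (⋃ k ∈ Finset.range (K + 1), E n ∩ A k) ∪ ⋂ k ≤ K, (A k)ᶜ := by
    intro y hy
    by_cases h : ∃ k ≤ K, y ∈ A k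
    · obtain ⟨k, hkK, hk⟩ := h
      exact Or.inl (Set.mem_biUnion (Finset.mem_range_succ_iff.2 hkK) ⟨hy, hk⟩)
    · right
      simpa using h
  calc μ (E n) ≤ μ (⋃ k ∈ Finset.range (K + 1), E n ∩ A k) + μ (⋂ k ≤ K, (A k)ᶜ) :=
        (measure_mono hsub).trans (measure_union_le _ _)
    _ ≤ ε / 2 + ε / 2 := add_le_add ((measure_biUnion_finset_le _ _).trans hn) hK
    _ = ε := ENNReal.add_halves ε

/-! ### Swapping a set with its injective image -/

open Classical in
/-- A Borel map that is injective on a Borel set `A` disjoint from its image agrees on `A` with a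
Borel involution that exchanges `A` and `φ '' A` and fixes all other points. -/
theorem exists_swap_of_injOn {Y : Type*} [MeasurableSpace Y] [StandardBorelSpace Y]
    {φ : Y → Y} (hφ : Measurable φ) {A : Set Y} (hA : MeasurableSet A) (hinj : Set.InjOn φ A)
    (hdisj : ∀ y ∈ A, φ y ∉ A) :
    ∃ ψ : Y ≃ᵐ Y, (∀ y, ψ (ψ y) = y) ∧ Set.EqOn ψ φ A ∧
      ∀ y, ψ y = y ∨ ψ y = φ y ∨ φ (ψ y) = y := by
  rcases isEmpty_or_nonempty Y with hY | hY
  · exact ⟨MeasurableEquiv.refl Y, fun y => hY.elim y, fun y => hY.elim y, fun y => hY.elim y⟩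
  set g := Function.invFunOn φ A
  set T : Y → Y := fun y => if y ∈ A then φ y else if y ∈ φ '' A then g y else y with hT
  have hTA : ∀ y ∈ A, T y = φ y := fun y hy => if_pos hy
  have hTim : ∀ y ∈ A, T (φ y) = y := fun y hy => by
    simp only [hT, if_neg (hdisj y hy), if_pos (Set.mem_image_of_mem φ hy)]
    exact hinj.leftInvOn_invFunOn hy
  have hTout : ∀ y, y ∉ A → y ∉ φ '' A → T y = y := fun y h1 h2 => by
    simp only [hT, if_neg h1, if_neg h2]
  have hinv : Function.Involutive T := by
    intro y
    by_cases h1 : y ∈ A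
    · rw [hTA y h1, hTim y h1]
    by_cases h2 : y ∈ φ '' A
    · obtain ⟨x, hx, rfl⟩ := h2
      rw [hTim x hx, hTA x hx]
    · rw [hTout y h1 h2, hTout y h1 h2]
  have himage : ∀ E, MeasurableSet E → MeasurableSet (φ '' (A ∩ E)) := fun E hE =>
    (hA.inter hE).image_of_measurable_injOn hφ (hinj.mono Set.inter_subset_left)
  have hAim : MeasurableSet (φ '' A) := by simpa using himage Set.univ MeasurableSet.univ
  have hTmeas : Measurable T := by
    intro E hE
    have hpre : T ⁻¹' E = (A ∩ φ ⁻¹' E) ∪ φ '' (A ∩ E) ∪ (E \ (A ∪ φ '' A)) := by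
      ext y
      by_cases h1 : y ∈ A
      · have h2 : y ∉ φ '' (A ∩ E) := by
          rintro ⟨x, hx, rfl⟩
          exact hdisj x hx.1 h1
        simp [hTA y h1, h1, h2]
      by_cases h2 : y ∈ φ '' A
      · obtain ⟨x, hx, rfl⟩ := h2
        have h3 : φ x ∈ φ '' (A ∩ E) ↔ x ∈ E := by
          rw [hinj.mem_image_iff Set.inter_subset_left hx]
          simp [hx]
        simp only [Set.mem_preimage, hTim x hx, Set.mem_union, Set.mem_inter_iff, h1, false_and,
          h3, false_or, Set.mem_sdiff, Set.mem_image_of_mem φ hx, or_true, not_true, and_false,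
          or_false]
      · have h3 : y ∉ φ '' (A ∩ E) := fun h => h2 (Set.image_mono Set.inter_subset_left h)
        simp only [Set.mem_preimage, hTout y h1 h2, Set.mem_union, Set.mem_inter_iff, h1, h2, h3,
          Set.mem_sdiff, false_and, false_or, or_false, not_false_eq_true, and_true]
    rw [hpre]
    exact ((hA.inter (hφ hE)).union (himage E hE)).union (hE.diff (hA.union hAim))
  refine ⟨⟨hinv.toPerm T, hTmeas, hTmeas⟩, hinv, hTA, fun y => ?_⟩
  change T y = y ∨ T y = φ y ∨ φ (T y) = y
  by_cases h1 : y ∈ A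
  · exact Or.inr (Or.inl (hTA y h1))
  by_cases h2 : y ∈ φ '' A
  · obtain ⟨x, hx, rfl⟩ := h2
    exact Or.inr (Or.inr (by rw [hTim x hx]))
  · exact Or.inl (hTout y h1 h2)

/-! ### Countable-to-one maps are injective on countably many pieces, almost everywhere -/

/-- Disintegration along a countable-to-one map: almost every point is an atom of the conditional
measure on its fibre. -/
theorem exists_kernel_fiber_singleton_ne_zero {Y Z : Type*} [MeasurableSpace Y]
    [StandardBorelSpace Y] [MeasurableSpace Z] [StandardBorelSpace Z] (μ : Measure Y)
    [IsProbabilityMeasure μ] {φ : Y → Z} (hφ : Measurable φ)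
    (hfib : ∀ z, (φ ⁻¹' {z}).Countable) :
    ∃ κ : ProbabilityTheory.Kernel Z Y, ProbabilityTheory.IsMarkovKernel κ ∧
      ∀ᵐ y ∂μ, κ (φ y) {y} ≠ 0 := by
  have : Nonempty Y := nonempty_of_isProbabilityMeasure μ
  have hgraph : Measurable fun y => (φ y, y) := hφ.prodMk measurable_id
  set ρ := μ.map fun y => (φ y, y) with hρ
  have : IsProbabilityMeasure ρ := Measure.isProbabilityMeasure_map hgraph.aemeasurable
  refine ⟨ρ.condKernel, inferInstance, ?_⟩
  have hatom : Measurable fun p : Z × Y => ρ.condKernel p.1 {p.2} := by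
    have hdiag : MeasurableSet {q : (Z × Y) × Y | q.2 = q.1.2} :=
      measurableSet_eq_fun measurable_snd (measurable_snd.comp measurable_fst)
    exact ProbabilityTheory.Kernel.measurable_kernel_prodMk_left
      (κ := ρ.condKernel.comap Prod.fst measurable_fst) hdiag
  have hset : MeasurableSet {p : Z × Y | ρ.condKernel p.1 {p.2} ≠ 0} :=
    hatom (measurableSet_singleton 0).compl
  have hgset : MeasurableSet {p : Z × Y | φ p.2 = p.1} :=
    measurableSet_eq_fun (hφ.comp measurable_snd) measurable_fst
  -- `ρ` is carried by the graph of `φ`, so its conditional measures are carried by the fibres.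
  have hcarried : ∀ᵐ z ∂ρ.fst, ∀ᵐ y ∂ρ.condKernel z, φ y = z := by
    rw [← Measure.ae_compProd_iff hgset, ρ.disintegrate, hρ, ae_map_iff hgraph.aemeasurable hgset]
    exact Eventually.of_forall fun y => rfl
  suffices h : ∀ᵐ z ∂ρ.fst, ∀ᵐ y ∂ρ.condKernel z, ρ.condKernel z {y} ≠ 0 by
    rw [← Measure.ae_compProd_iff hset, ρ.disintegrate] at h
    exact ae_of_ae_map hgraph.aemeasurable h
  filter_upwards [hcarried] with z hz
  -- The points of a countable fibre that are not atoms form a null set.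
  have hnull : ρ.condKernel z {y ∈ φ ⁻¹' {z} | ρ.condKernel z {y} = 0} = 0 := by
    rw [← Set.biUnion_of_singleton {y ∈ φ ⁻¹' {z} | ρ.condKernel z {y} = 0},
      measure_biUnion_null_iff ((hfib z).mono (Set.sep_subset _ _))]
    exact fun y hy => hy.2
  rw [measure_eq_zero_iff_ae_notMem] at hnull
  filter_upwards [hz, hnull] with y hy hy' h0
  exact hy' ⟨hy, h0⟩

/-- A countable basis of a Polish topology contains sets that isolate each atom, in mass, from the
rest of a finite measure. The factor `2` only has to exceed `1`. -/
theorem exists_countable_sets_measure_lt_two_mul_singleton (Y : Type*) [MeasurableSpace Y]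
    [StandardBorelSpace Y] :
    ∃ 𝒟 : Set (Set Y), 𝒟.Countable ∧ (∀ D ∈ 𝒟, MeasurableSet D) ∧
      ∀ (ν : Measure Y) [IsFiniteMeasure ν] (y z : Y), y ≠ z → ν {y} ≠ 0 →
        ∃ D ∈ 𝒟, y ∈ D ∧ z ∉ D ∧ ν D < 2 * ν {y} := by
  let _ := upgradeStandardBorel Y
  refine ⟨TopologicalSpace.countableBasis Y, TopologicalSpace.countable_countableBasis Y,
    fun D hD => (TopologicalSpace.isOpen_of_mem_countableBasis hD).measurableSet,
    fun ν _ y z hyz hy => ?_⟩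
  have hlt : ν {y} < 2 * ν {y} := by
    rw [two_mul]
    exact ENNReal.lt_add_right (measure_ne_top ν _) hy
  obtain ⟨U, hyU, hU, hνU⟩ := Set.exists_isOpen_lt_of_lt {y} _ hlt
  obtain ⟨D, hD, hyD, hDU⟩ :=
    (TopologicalSpace.isBasis_countableBasis Y).exists_subset_of_mem_open
      (show y ∈ U \ {z} from ⟨hyU rfl, hyz⟩) (hU.sdiff isClosed_singleton)
  exact ⟨D, hD, hyD, fun h => (hDU h).2 rfl,
    (measure_mono (hDU.trans Set.sdiff_subset)).trans_lt hνU⟩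

/-- In a fibre, two distinct points cannot each carry more than half of the mass of a set that
contains both. -/
theorem injOn_setOf_measure_lt_two_mul_singleton {Y Z : Type*} [MeasurableSpace Y]
    [MeasurableSingletonClass Y] (κ : Z → Measure Y) (φ : Y → Z) (D : Set Y) :
    Set.InjOn φ {y ∈ D | κ (φ y) D < 2 * κ (φ y) {y}} := by
  rintro x ⟨hxD, hx⟩ y ⟨hyD, hy⟩ hxy
  by_contra hne
  rw [← hxy] at hy
  have hpair : κ (φ x) {x} + κ (φ x) {y} ≤ κ (φ x) D := by
    rw [← measure_union (Set.disjoint_singleton.2 hne) (measurableSet_singleton y)]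
    exact measure_mono (Set.union_subset (Set.singleton_subset_iff.2 hxD)
      (Set.singleton_subset_iff.2 hyD))
  have h := ENNReal.add_lt_add hx hy
  rw [← mul_add, ← two_mul] at h
  exact absurd (mul_le_mul_right hpair 2) (not_le.2 h)

/-! ### Approximation of Borel maps by the full group -/

/-- Up to a null set, a Borel map with graph in `R` is pieced together from countably many elements
of the full group, which can be taken to be involutions. -/
theorem exists_ae_cover_eqOn_borelFullGroup {Y : Type*} [MeasurableSpace Y]
    [StandardBorelSpace Y] (μ : Measure Y) [IsProbabilityMeasure μ] {R : Setoid Y}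
    (hR : ∀ x : Y, {y : Y | R x y}.Countable) {φ : Y → Y} (hφ : Measurable φ)
    (hφR : ∀ y, R y (φ y)) :
    ∃ A : ℕ → Set Y, (∀ k, MeasurableSet (A k)) ∧ (∀ᵐ y ∂μ, ∃ k, y ∈ A k) ∧
      ∀ k, ∃ ψ ∈ borelFullGroup R, (∀ y, ψ (ψ y) = y) ∧ Set.EqOn ψ φ (A k) := by
  have hfib : ∀ z, (φ ⁻¹' {z}).Countable := fun z =>
    (hR z).mono fun y (hy : φ y = z) => R.symm (hy ▸ hφR y)
  obtain ⟨κ, _, hκ⟩ := exists_kernel_fiber_singleton_ne_zero μ hφ hfib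
  obtain ⟨𝒟, h𝒟, h𝒟meas, hiso⟩ := exists_countable_sets_measure_lt_two_mul_singleton Y
  set S : Set Y → Set Y := fun D =>
    {y ∈ D | κ (φ y) D < 2 * κ (φ y) {y}} ∩ (φ ⁻¹' D)ᶜ with hS
  have hatom : Measurable fun y => κ (φ y) {y} := by
    have hdiag : MeasurableSet {q : Y × Y | q.2 = q.1} :=
      measurableSet_eq_fun measurable_snd measurable_fst
    exact ProbabilityTheory.Kernel.measurable_kernel_prodMk_left (κ := κ.comap φ hφ) hdiag
  have hSmeas : ∀ D ∈ 𝒟, MeasurableSet (S D) := fun D hD =>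
    ((h𝒟meas D hD).inter (measurableSet_lt ((κ.measurable_coe (h𝒟meas D hD)).comp hφ)
      (hatom.const_mul 2))).inter (hφ (h𝒟meas D hD)).compl
  obtain ⟨A, hA⟩ := ((h𝒟.image S).insert {y | φ y = y}).exists_eq_range (Set.insert_nonempty _ _)
  have hAmem : ∀ k, A k = {y | φ y = y} ∨ ∃ D ∈ 𝒟, S D = A k := fun k => by
    have : A k ∈ insert {y | φ y = y} (S '' 𝒟) := hA ▸ Set.mem_range_self k
    simpa using this
  refine ⟨A, fun k => ?_, ?_, fun k => ?_⟩
  · rcases hAmem k with h | ⟨D, hD, h⟩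
    · rw [h]
      exact measurableSet_eq_fun hφ measurable_id
    · rw [← h]
      exact hSmeas D hD
  · filter_upwards [hκ] with y hy
    suffices h : ∃ s ∈ insert {y | φ y = y} (S '' 𝒟), y ∈ s by
      rw [hA] at h
      simpa using h
    by_cases hfix : φ y = y
    · exact ⟨_, Set.mem_insert _ _, hfix⟩
    · obtain ⟨D, hD, hyD, hφyD, hlt⟩ := hiso (κ (φ y)) y (φ y) (Ne.symm hfix) hy
      exact ⟨S D, Set.mem_insert_of_mem _ (Set.mem_image_of_mem S hD), ⟨hyD, hlt⟩, hφyD⟩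
  · rcases hAmem k with h | ⟨D, hD, h⟩
    · refine ⟨MeasurableEquiv.refl Y, fun y => R.refl y, fun y => rfl, fun y hy => ?_⟩
      rw [h] at hy
      exact hy.symm
    · rw [← h]
      obtain ⟨ψ, hinv, hEq, hψ⟩ := exists_swap_of_injOn hφ (hSmeas D hD)
        ((injOn_setOf_measure_lt_two_mul_singleton κ φ D).mono Set.inter_subset_left)
        (fun y hy hy' => hy.2 hy'.1.1)
      refine ⟨ψ, fun y => ?_, hinv, hEq⟩
      rcases hψ y with h | h | h
      · rw [h]
      · rw [h]
        exact hφR y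
      · have := R.symm (hφR (ψ y))
        rwa [h] at this

theorem mainTheorem6 {Y : Type*} [MeasurableSpace Y] [StandardBorelSpace Y]
    (μ : Measure Y) [IsProbabilityMeasure μ]
    (R : Setoid Y) (hR : IsCountableBorelRel R) (hμ : IsRelInvariantMeasure R μ)
    (B : ℕ → Set Y) (hB : ∀ n, MeasurableSet (B n)) :
    IsAsympInvariant R μ B ↔
      ∀ φ : Y → Y, Measurable φ → (∀ y : Y, R y (φ y)) →
        Tendsto (fun n => μ ((φ ⁻¹' B n) ∆ B n)) atTop (𝓝 0) := by
  constructor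
  · intro h φ hφ hφR
    obtain ⟨A, hA, hcover, hψ⟩ := exists_ae_cover_eqOn_borelFullGroup μ hR.countable_classes hφ hφR
    refine tendsto_measure_zero_of_ae_cover hA hcover fun k => ?_
    obtain ⟨ψ, hψR, hinv, hEq⟩ := hψ k
    refine tendsto_of_tendsto_of_tendsto_of_le_of_le tendsto_const_nhds (h ψ hψR)
      (fun n => zero_le) fun n => measure_mono ?_
    -- `ψ` is an involution, so images and preimages under it agree.
    have himage : ψ '' B n = ψ ⁻¹' B n :=
      congrFun (Set.image_eq_preimage_of_inverse hinv hinv) (B n)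
    rintro y ⟨hy, hyA⟩
    rw [himage]
    simpa only [Set.mem_symmDiff, Set.mem_preimage, hEq hyA] using hy
  · intro h φ hφ
    have hsymm : ∀ y, R y (φ.symm y) := fun y => by
      have := R.symm (hφ (φ.symm y))
      rwa [φ.apply_symm_apply] at this
    simpa only [MeasurableEquiv.image_eq_preimage_symm] using h φ.symm φ.symm.measurable hsymm
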